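/- Let $n,k,r$ be positive integers with $r\ge 2$ and $n\ge rk$. Place the points $1,\dots,n$ in clockwise order on a circle. Call a $k$-subset $P$ of $\{1,\dots,n\}$ $r$-stable if for any two distinct points $a,b\in P$ there are at least $r-1$ of the $n$ points strictly between $a$ and $b$ on each of the two arcs of the circle joining them. The $r$-stable interlacing graph $\mathrm{IG}_{n,k}^{(r)}$ has as vertices the $r$-stable $k$-subsets of $\{1,\dots,n\}$, and two vertices $P=\{p_1<\dots<p_k\}$ and $Q=\{q_1<\dots<q_k\}$ are adjacent if and only if they interlace, i.e. $p_1<q_1<p_2<q_2<\dots<p_k<q_k$ or $q_1<p_1<q_2<p_2<\dots<q_k<p_k$. For integers $1\le K\le N$, a circular coloring of size $N/K$ of a finite graph $G=(V,E)$ is a map $\chi:V\to\mathbb{Z}/N\mathbb{Z}$ such that for every edge $vw\in E$ the difference $\chi(v)-\chi(w)$ is the class modulo $N$ of an integer $j$ with $K\le j\le N-K$. The circular chromatic number $\chi_c(G)$ is the minimum of the rational numbers $N/K$ for which $G$ has a circular coloring of size $N/K$. Then $\chi_c\bigl(\mathrm{IG}_{n,k}^{(r)}\bigr)=\dfrac{n}{k}$,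 and this minimum is attained. -/

import Mathlib

/-- A `k`-polygon on `n` points: a `k`-element subset of the `n` points `0 < 1 < ⋯ < n - 1`, which
lie in clockwise order on a circle. -/
abbrev CirclePolygon (n k : ℕ) : Type := {P : Finset (Fin n) // P.card = k}

namespace CirclePolygon

/-- The `i`-th vertex of a polygon in increasing order, `p_1 < ⋯ < p_k` (here indexed from `0`). -/
def vertex {n k : ℕ} (P : CirclePolygon n k) : Fin k ↪o Fin n := P.1.orderEmbOfFin P.2

/-- `P` is `r`-stable: on both arcs of the circle between two distinct points `a < b` of `P` there
are at least `r - 1` further points, i.e. the clockwise distances `b - a` and `n - (b - a)` are both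
at least `r`. -/
def IsStable {n k : ℕ} (r : ℕ) (P : CirclePolygon n k) : Prop :=
  ∀ a ∈ P.1, ∀ b ∈ P.1, a < b → (a : ℕ) + r ≤ b ∧ (b : ℕ) + r ≤ a + n

/-- `p_1 < q_1 < p_2 < q_2 < ⋯ < p_k < q_k`. -/
def Alternates {n k : ℕ} (P Q : CirclePolygon n k) : Prop :=
  (∀ i, P.vertex i < Q.vertex i) ∧
    ∀ i j : Fin k, (i : ℕ) + 1 = j → Q.vertex i < P.vertex j

end CirclePolygon

/-- The `r`-stable interlacing graph on the `r`-stable `k`-polygons on `n` points: distinct `P` and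
`Q` are adjacent iff `p_1 < q_1 < ⋯ < p_k < q_k` or `q_1 < p_1 < ⋯ < q_k < p_k`. -/
def interlacingGraph (n k r : ℕ) : SimpleGraph {P : CirclePolygon n k // P.IsStable r} :=
  SimpleGraph.fromRel fun P Q => P.1.Alternates Q.1

/-- `χ` is a circular coloring of size `N / K`: the colors of adjacent vertices differ by one of the
classes of `K, K + 1, …, N - K` modulo `N`. -/
def IsCircularColoring {V : Type*} (G : SimpleGraph V) (N K : ℕ) (χ : V → ZMod N) : Prop :=
  ∀ v w, G.Adj v w → ∃ j : ℕ, K ≤ j ∧ j + K ≤ N ∧ χ v - χ w = (j : ZMod N)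

/-- The numbers `N / K`, for integers `1 ≤ K ≤ N`, such that `G` has a circular coloring of size
`N / K`. -/
def circularColoringSizes {V : Type*} (G : SimpleGraph V) : Set ℝ :=
  {x | ∃ N K : ℕ, 0 < K ∧ K ≤ N ∧ x = (N : ℝ) / K ∧ ∃ χ : V → ZMod N, IsCircularColoring G N K χ}

/-- The circular chromatic number of `G`: the least size of a circular coloring. -/
noncomputable def circularChromaticNumber {V : Type*} (G : SimpleGraph V) : ℝ :=
  sInf (circularColoringSizes G)

/-! Upper bound: if `P` alternates with `Q`, the vertex sum grows by at least `k` and at most `n -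
k`, so the sum modulo `n` is a coloring of size `n / k`. Lower bound: balanced polygons with offsets
at circular distance at least `k` interlace. A color arc of length `K` thus holds at most `k` of the
`n` offsets, and counting over all `N` arcs gives `n * K ≤ N * k`. -/

/-- A subset of `{0, …, n - 1}` with no two elements at circular distance at least `k` has at most
`k` elements, provided `2 * k ≤ n`. -/
theorem card_le_of_forall_circular_dist_lt {n k : ℕ} (hn : 2 * k ≤ n) {S : Finset ℕ}
    (hS : ∀ t ∈ S, t < n) (hind : ∀ t ∈ S, ∀ s ∈ S, t + k ≤ s → n + t < s + k) :
    S.card ≤ k := by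
  rcases S.eq_empty_or_nonempty with rfl | hne
  · simp
  set m := S.min' hne with hm
  have hmS : m ∈ S := S.min'_mem hne
  have hle : ∀ t ∈ S, m ≤ t := fun t ht => S.min'_le t ht
  have hcard : (Finset.Ico m (m + k)).card = k := by simp
  rw [← hcard]
  -- Fold the elements preceding `m` cyclically into the window after `m`. A collision would need
  -- `t` and `t + n - k` both in `S`, at circular distance `k`.
  refine Finset.card_le_card_of_injOn (fun t => if t < m + k then t else t + k - n) ?_ ?_
  · intro t ht
    have h1 := hle t ht
    have h2 := hS t ht
    have h3 := hind m hmS t ht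
    simp only [Finset.coe_Ico, Set.mem_Ico]
    split_ifs <;> omega
  · intro t ht s hs hts
    have h1 := hind t ht s hs
    have h2 := hind s hs t ht
    have h3 := hind m hmS t ht
    have h4 := hind m hmS s hs
    simp only at hts
    split_ifs at hts <;> omega

/-- A map from `{0, …, n - 1}` to `ZMod N` such that each preimage of `K ≤ N` consecutive classes
has at most `k` elements exists only if `n * K ≤ N * k`. -/
theorem mul_le_mul_of_card_preimage_arc_le {n k N K : ℕ} [NeZero N] (hKN : K ≤ N)
    (f : ℕ → ZMod N)
    (hf : ∀ c : ZMod N,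
      ((Finset.range n).filter fun t => ∃ a : ℕ, a < K ∧ f t = c + (a : ZMod N)).card ≤ k) :
    n * K ≤ N * k := by
  classical
  -- Double counting: each `t` lies in the `K` arcs starting at `f t - a`, `a < K`.
  have h := Finset.card_eq_sum_card_fiberwise (s := Finset.range n ×ˢ Finset.range K)
    (t := (Finset.univ : Finset (ZMod N))) (f := fun x => f x.1 - (x.2 : ZMod N))
    (fun _ _ => Finset.mem_coe.2 (Finset.mem_univ _))
  rw [Finset.card_product, Finset.card_range, Finset.card_range] at h
  rw [h]
  refine (Finset.sum_le_card_nsmul _ _ k fun c _ => ?_).trans_eq (by simp [ZMod.card])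
  refine (Finset.card_le_card_of_injOn Prod.fst ?_ ?_).trans (hf c)
  · rintro ⟨t, a⟩ hta
    simp only [Finset.coe_filter, Finset.mem_product, Finset.mem_range, Set.mem_ofPred_eq] at hta ⊢
    exact ⟨hta.1.1, a, hta.1.2, by rw [← hta.2]; ring⟩
  · rintro ⟨t, a⟩ hta ⟨s, b⟩ hsb hts
    simp only [Finset.coe_filter, Finset.mem_product, Finset.mem_range, Set.mem_ofPred_eq]
      at hta hsb hts
    subst hts
    have hab : (a : ZMod N) = b := sub_right_injective (hta.2.trans hsb.2.symm)
    rw [ZMod.natCast_eq_natCast_iff'] at hab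
    rw [Nat.mod_eq_of_lt (by omega), Nat.mod_eq_of_lt (by omega)] at hab
    rw [hab]

/-- In a circular coloring of size `N / K`, no two adjacent vertices have their colors in the same
arc of `K` consecutive classes. -/
theorem IsCircularColoring.not_adj_of_mem_arc {V : Type*} {G : SimpleGraph V} {N K : ℕ}
    {χ : V → ZMod N} (hχ : IsCircularColoring G N K χ) {v w : V} {c : ZMod N} {a b : ℕ}
    (ha : a < K) (hb : b < K) (hv : χ v = c + a) (hw : χ w = c + b) : ¬ G.Adj v w := by
  intro h
  obtain ⟨j, hj, hjN, hvw⟩ := hχ v w h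
  have h0 : (((b + j : ℕ) : ℤ) : ZMod N) = ((a : ℤ) : ZMod N) := by
    push_cast
    rw [← hvw, hv, hw]
    ring
  rw [ZMod.intCast_eq_intCast_iff_dvd_sub] at h0
  have h1 : (N : ℤ) ∣ ((b + j : ℕ) : ℤ) - a := by
    rw [← neg_sub]
    exact h0.neg_right
  -- Here `0 < b + j - a < N`, since `a < K ≤ j` and `b < K ≤ N - j`.
  have := Int.le_of_dvd (by omega) h1
  omega

/-- Translating `x` by `m * d` or more moves the quotient by `d` by at least `m`. -/
theorem Nat.div_add_le_div {d m x y : ℕ} (hd : 0 < d) (h : x + m * d ≤ y) :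
    x / d + m ≤ y / d := by
  rw [← Nat.add_mul_div_right x m hd]
  exact Nat.div_le_div_right h

namespace CirclePolygon

theorem Alternates.ne {n k : ℕ} (hk : 0 < k) {P Q : CirclePolygon n k} (h : P.Alternates Q) :
    P ≠ Q := by
  rintro rfl
  exact lt_irrefl _ (h.1 ⟨0, hk⟩)

/-- The sum of the vertices of a polygon. -/
def vertexSum {n k : ℕ} (P : CirclePolygon n k) : ℕ := ∑ i, (P.vertex i : ℕ)

theorem Alternates.vertexSum_add_le {n k : ℕ} {P Q : CirclePolygon n k} (h : P.Alternates Q) :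
    P.vertexSum + k ≤ Q.vertexSum := by
  have : ∑ i, ((P.vertex i : ℕ) + 1) ≤ ∑ i, (Q.vertex i : ℕ) :=
    Finset.sum_le_sum fun i _ => h.1 i
  simpa [vertexSum, Finset.sum_add_distrib] using this

/-- Pair each `q_i` with `p_(i+1)`; the unpaired `q_k` and `p_1` satisfy `q_k + 1 ≤ n + p_1`. -/
theorem Alternates.vertexSum_add_le_add {n k : ℕ} (hk : 0 < k) {P Q : CirclePolygon n k}
    (h : P.Alternates Q) : Q.vertexSum + k ≤ P.vertexSum + n := by
  obtain ⟨l, rfl⟩ : ∃ l, k = l + 1 := ⟨k - 1, by omega⟩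
  have h1 : ∑ i : Fin l, ((Q.vertex i.castSucc : ℕ) + 1) ≤ ∑ i : Fin l, (P.vertex i.succ : ℕ) :=
    Finset.sum_le_sum fun i _ => h.2 i.castSucc i.succ (by simp)
  have h2 := (Q.vertex (Fin.last l)).isLt
  rw [Finset.sum_add_distrib] at h1
  simp only [Finset.sum_const, Finset.card_univ, Fintype.card_fin, smul_eq_mul, mul_one] at h1
  rw [vertexSum, vertexSum, Fin.sum_univ_castSucc, Fin.sum_univ_succ]
  omega

/-- The vertices `⌊(i * n + t) / k⌋` of the balanced polygon with offset `t`. -/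
def balancedVertex {n k : ℕ} (t : Fin n) (i : Fin k) : Fin n :=
  ⟨(i * n + t) / k, by
    rw [Nat.div_lt_iff_lt_mul i.pos]
    calc (i : ℕ) * n + t < i * n + n := by omega
      _ = (i + 1) * n := by ring
      _ ≤ k * n := Nat.mul_le_mul_right n i.isLt
      _ = n * k := mul_comm k n⟩

theorem balancedVertex_add_le {n k r : ℕ} (hn : r * k ≤ n) (t : Fin n) {i j : Fin k}
    (hij : i < j) : (balancedVertex t i : ℕ) + r ≤ balancedVertex t j := by
  refine Nat.div_add_le_div i.pos ?_
  have : ((i : ℕ) + 1) * n ≤ j * n := Nat.mul_le_mul_right n hij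
  linarith

theorem balancedVertex_add_le_add {n k r : ℕ} (hn : r * k ≤ n) (t : Fin n) (i j : Fin k) :
    (balancedVertex t j : ℕ) + r ≤ balancedVertex t i + n := by
  have hk := i.pos
  change (j * n + t) / k + r ≤ (i * n + t) / k + n
  rw [← Nat.add_mul_div_right _ n hk]
  refine Nat.div_add_le_div hk ?_
  have : ((j : ℕ) + 1) * n ≤ k * n := Nat.mul_le_mul_right n j.isLt
  linarith [Nat.zero_le ((i : ℕ) * n)]

theorem balancedVertex_strictMono {n k : ℕ} (hn : k ≤ n) (t : Fin n) :
    StrictMono (balancedVertex t : Fin k → Fin n) := fun _ _ hij =>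
  Fin.lt_def.2 (balancedVertex_add_le (r := 1) (by omega) t hij)

/-- The balanced polygon with offset `t`, a polygon with all gaps `⌊n / k⌋` or `⌈n / k⌉`. -/
def balanced {n k : ℕ} (hn : k ≤ n) (t : Fin n) : CirclePolygon n k :=
  ⟨Finset.univ.map ⟨balancedVertex t, (balancedVertex_strictMono hn t).injective⟩, by simp⟩

theorem vertex_balanced {n k : ℕ} (hn : k ≤ n) (t : Fin n) (i : Fin k) :
    (balanced hn t).vertex i = balancedVertex t i := by
  have := Finset.orderEmbOfFin_unique (balanced hn t).2 (f := balancedVertex t)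
    (fun x => by simp [balanced]) (balancedVertex_strictMono hn t)
  exact (congrFun this i).symm

theorem isStable_balanced {n k r : ℕ} (hn : k ≤ n) (hrn : r * k ≤ n) (t : Fin n) :
    (balanced hn t).IsStable r := by
  intro a ha b hb hab
  simp only [balanced, Finset.mem_map, Finset.mem_univ, true_and,
    Function.Embedding.coeFn_mk] at ha hb
  obtain ⟨i, rfl⟩ := ha
  obtain ⟨j, rfl⟩ := hb
  exact ⟨balancedVertex_add_le hrn t ((balancedVertex_strictMono hn t).lt_iff_lt.1 hab),
    balancedVertex_add_le_add hrn t i j⟩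

/-- The numerators grow by `s - t` and by `n - (s - t)` in turn; both are at least `k`, so each
quotient increases. -/
theorem alternates_balanced {n k : ℕ} (hn : k ≤ n) {t s : Fin n} (hts : (t : ℕ) + k ≤ s)
    (hst : (s : ℕ) + k ≤ n + t) : (balanced hn t).Alternates (balanced hn s) := by
  refine ⟨fun i => ?_, fun i j hij => ?_⟩
  · rw [vertex_balanced, vertex_balanced, Fin.lt_def]
    exact Nat.div_add_le_div (m := 1) i.pos (by omega)
  · rw [vertex_balanced, vertex_balanced, Fin.lt_def]
    refine Nat.div_add_le_div (m := 1) i.pos ?_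
    rw [← hij, add_mul]
    omega

end CirclePolygon

open CirclePolygon in
/-- The sum of the vertices modulo `n` is a circular coloring of the interlacing graph of size
`n / k`. -/
theorem isCircularColoring_vertexSum {n k : ℕ} (hk : 0 < k) (r : ℕ) :
    IsCircularColoring (interlacingGraph n k r) n k fun P => (P.1.vertexSum : ZMod n) := by
  have key : ∀ P Q : CirclePolygon n k, P.Alternates Q → ∃ j : ℕ, k ≤ j ∧ j + k ≤ n ∧
      Q.vertexSum = P.vertexSum + j := fun P Q h => by
    have h1 := h.vertexSum_add_le
    have h2 := h.vertexSum_add_le_add hk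
    exact ⟨Q.vertexSum - P.vertexSum, by omega, by omega, by omega⟩
  intro P Q hPQ
  rcases ((SimpleGraph.fromRel_adj _ _ _).1 hPQ).2 with h | h
  · obtain ⟨j, hj, hjn, hs⟩ := key _ _ h
    refine ⟨n - j, by omega, by omega, ?_⟩
    simp only [hs]
    rw [Nat.cast_sub (by omega)]
    simp
  · obtain ⟨j, hj, hjn, hs⟩ := key _ _ h
    exact ⟨j, hj, hjn, by simp [hs]⟩

open CirclePolygon in
/-- A circular coloring of the interlacing graph has size at least `n / k`. -/
theorem mul_le_mul_of_isCircularColoring {n k r N K : ℕ} (hk : 0 < k) (hr : 2 ≤ r)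
    (hn : r * k ≤ n) (hK : 0 < K) (hKN : K ≤ N)
    {χ : {P : CirclePolygon n k // P.IsStable r} → ZMod N}
    (hχ : IsCircularColoring (interlacingGraph n k r) N K χ) : n * K ≤ N * k := by
  have h2k : 2 * k ≤ n := (Nat.mul_le_mul_right k hr).trans hn
  have hkn : k ≤ n := by omega
  have : NeZero N := ⟨by omega⟩
  let B : Fin n → {P : CirclePolygon n k // P.IsStable r} := fun t =>
    ⟨balanced hkn t, isStable_balanced hkn hn t⟩
  -- The default `0` is harmless: only `t < n` is counted.
  refine mul_le_mul_of_card_preimage_arc_le hKN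
    (fun t => if h : t < n then χ (B ⟨t, h⟩) else 0) fun c => ?_
  refine card_le_of_forall_circular_dist_lt h2k (fun t ht => ?_) fun t ht s hs hts => ?_
  · exact Finset.mem_range.1 (Finset.mem_filter.1 ht).1
  · simp only [Finset.mem_filter, Finset.mem_range] at ht hs
    obtain ⟨htn, a, ha, hta⟩ := ht
    obtain ⟨hsn, b, hb, hsb⟩ := hs
    rw [dif_pos htn] at hta
    rw [dif_pos hsn] at hsb
    by_contra! hst
    refine hχ.not_adj_of_mem_arc ha hb hta hsb ?_
    have halt : (B ⟨t, htn⟩).1.Alternates (B ⟨s, hsn⟩).1 := alternates_balanced hkn hts hst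
    exact (SimpleGraph.fromRel_adj _ _ _).2 ⟨fun h => halt.ne hk (congrArg _ h), Or.inl halt⟩

theorem theorem1 (n k r : ℕ) (hk : 0 < k) (hr : 2 ≤ r) (hn : r * k ≤ n) :
    circularChromaticNumber (interlacingGraph n k r) = (n : ℝ) / k ∧
      IsLeast (circularColoringSizes (interlacingGraph n k r)) ((n : ℝ) / k) := by
  have h2k : 2 * k ≤ n := (Nat.mul_le_mul_right k hr).trans hn
  have hleast : IsLeast (circularColoringSizes (interlacingGraph n k r)) ((n : ℝ) / k) := by
    refine ⟨⟨n, k, hk, by omega, rfl, _, isCircularColoring_vertexSum hk r⟩, ?_⟩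
    rintro _ ⟨N, K, hK, hKN, rfl, χ, hχ⟩
    rw [div_le_div_iff₀ (by exact_mod_cast hk) (by exact_mod_cast hK)]
    exact_mod_cast mul_le_mul_of_isCircularColoring hk hr hn hK hKN hχ
  exact ⟨hleast.csInf_eq, hleast⟩
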